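/- Let $(\varphi_n)_{n\ge 1}$ be an orthonormal system of real-valued functions in $L_2([0,1])$. For $f\in L_2([0,1])$ let $C_n(f)=\int_0^1 f(x)\varphi_n(x)\,dx$ be its Fourier coefficients. For $\varepsilon\in(0,1)$ put $p(\varepsilon)=2-\varepsilon$ and $q(\varepsilon)=\frac{2-\varepsilon}{1-\varepsilon}$, and for a real sequence $a=(a_k)_{k\ge 1}$ and $n\ge 1$ put $$M_n(a,\varepsilon)=\frac1n\sum_{i=1}^{n-1}\left|\int_0^{i/n}\sum_{k=1}^n a_k\varphi_k(x)\,dx\right|.$$ Suppose that for some $\varepsilon\in(0,1)$ we have $(C_n(l))_{n\ge1}\in\ell_{p(\varepsilon)}$, where $l(x)=1$ for $x\in[0,1]$, and that for every $a\in\ell_{q(\varepsilon)}$ the sequence $(M_n(a,\varepsilon))_{n\ge 1}$ is bounded (with a bound that may depend on $a$ and $\varepsilon$). Then for every $f\in\mathrm{Lip}_1$, that is, every $f:[0,1]\to\mathbb R$ that is Lipschitz on $[0,1]$, the Fourier series $$\sum_{n=1}^\infty C_n(f)\varphi_n(x)$$ converges unconditionally almost everywhere on $[0,1]$: for every permutation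 $\sigma$ of the positive integers, the series $\sum_{n=1}^\infty C_{\sigma(n)}(f)\varphi_{\sigma(n)}(x)$ converges for almost every $x\in[0,1]$. -/

import Mathlib

open MeasureTheory Set Filter Topology

noncomputable section

/-- Real-valued `L₂([0,1])`, with Lebesgue measure. -/
abbrev L2Unit : Type := Lp ℝ 2 (volume.restrict (Icc (0 : ℝ) 1))

/-- The class `Lip₁` on `[0,1]`: real functions satisfying a Lipschitz condition of order `1`.
Only the values on `[0,1]` matter. -/
def IsLip1 (f : ℝ → ℝ) : Prop := ∃ K : NNReal, LipschitzOnWith K f (Icc 0 1)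

/-- The Fourier coefficient `C_n(f) = ∫₀¹ f(x) φ_n(x) dx`. Systems are indexed from `0`, so
index `n` here stands for the `(n + 1)`-st function of the system. -/
def fourierCoef (φ : ℕ → L2Unit) (f : ℝ → ℝ) (n : ℕ) : ℝ :=
  ∫ x in (0 : ℝ)..1, f x * φ n x

/-- `P_n(a, x)`: the linear combination of the first `n` functions of the system with the first
`n` terms of the sequence `a`. -/
def partialComb (φ : ℕ → L2Unit) (a : ℕ → ℝ) (n : ℕ) (x : ℝ) : ℝ :=
  ∑ k ∈ Finset.range n, a k * φ k x

/-- `M_n(a) = (1/n) ∑_{i=1}^{n-1} |∫₀^{i/n} P_n(a, x) dx|`. -/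
def meanPrimitive (φ : ℕ → L2Unit) (a : ℕ → ℝ) (n : ℕ) : ℝ :=
  (1 / (n : ℝ)) *
    ∑ i ∈ Finset.Ico 1 n, |∫ x in (0 : ℝ)..((i : ℝ) / (n : ℝ)), partialComb φ a n x|

/-- The series `∑ u_n(x)` converges unconditionally almost everywhere on `[0,1]`: every
rearrangement of it converges almost everywhere (the exceptional null set may depend on the
rearrangement). -/
def UnconditionallyConvergesAE (u : ℕ → ℝ → ℝ) : Prop :=
  ∀ σ : Equiv.Perm ℕ, ∀ᵐ x ∂(volume.restrict (Icc (0 : ℝ) 1)),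
    ∃ s : ℝ, Tendsto (fun N : ℕ => ∑ n ∈ Finset.range N, u (σ n) x) atTop (𝓝 s)

end

/-! The coefficients of a Lipschitz `f` lie in `ℓ_p` with `p = 2 - ε < 2`, and that alone forces
unconditional convergence. For `a ∈ ℓ_q` the pairing `∑ a_k C_k(f)` is the integral of `f` against
`P_n(a)`. Abel summation over the partition into `n` cells bounds it by three terms: `M_n(a)`,
bounded by hypothesis; `(K/n) ∫|P_n|`, bounded by orthonormality; and `|f 1| |∫P_n|`, bounded by
Hölder since the coefficients of `1` are in `ℓ_p`. Banach–Steinhaus then gives the `ℓ_p` claim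
(`memℓp_of_bounded_pairing`). For convergence, terms are grouped by dyadic size. Level `k` has
`O(4^k)` terms, so `rademacher_menshov` costs a factor `O((k+1)^2)`, while the squared `L₂` mass of
the level decays geometrically because `p < 2`. Hence the block maxima are summable almost
everywhere. Rearranging the terms changes nothing. -/

/-! ### Almost everywhere convergence of orthogonal series -/

section OrthogonalSeries

variable {α : Type*} [MeasurableSpace α] {μ : Measure α} {u : ℕ → α → ℝ}

theorem integrable_sq_sum (hu : ∀ n, MemLp (u n) 2 μ) (s : Finset ℕ) :
    Integrable (fun x => (∑ n ∈ s, u n x) ^ 2) μ :=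
  (memLp_finsetSum s fun n _ => hu n).integrable_sq

theorem integral_sq_sum_of_orthogonal (hu : ∀ n, MemLp (u n) 2 μ)
    (horth : ∀ i j, i ≠ j → ∫ x, u i x * u j x ∂μ = 0) (s : Finset ℕ) :
    ∫ x, (∑ n ∈ s, u n x) ^ 2 ∂μ = ∑ n ∈ s, ∫ x, u n x ^ 2 ∂μ := by
  have hint : ∀ i j, Integrable (fun x => u i x * u j x) μ := fun i j =>
    (hu i).integrable_mul (hu j)
  simp_rw [pow_two, Finset.sum_mul_sum]
  rw [integral_finsetSum _ fun i _ => integrable_finsetSum _ fun j _ => hint i j]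
  refine Finset.sum_congr rfl fun i hi => ?_
  rw [integral_finsetSum _ fun j _ => hint i j]
  exact Finset.sum_eq_single_of_mem i hi fun j _ hji => horth i j hji.symm

/-- A finite set of at most `2 * k` natural numbers is cut into two initial and final pieces of at
most `k` elements each. -/
theorem exists_threshold_card_le (s : Finset ℕ) (k : ℕ) (hs : s.card ≤ 2 * k) :
    ∃ t, (s.filter (· < t)).card ≤ k ∧ (s.filter (¬ · < t)).card ≤ k := by
  have hex : ∃ t, (s.filter (¬ · < t)).card ≤ k := by
    refine ⟨s.sup id + 1, ?_⟩
    rw [Finset.filter_eq_empty_iff.2]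
    · simp
    · intro n hn
      simpa using Nat.lt_succ_of_le (Finset.le_sup (f := id) hn)
  classical
  -- At the least such `t`, moving the cut one step back leaves more than `k` elements on the right,
  -- so fewer than `k` on the left; stepping forward adds at most one.
  refine ⟨Nat.find hex, ?_, Nat.find_spec hex⟩
  rcases h : Nat.find hex with _ | t
  · simp
  · have hmin : k < (s.filter (¬ · < t)).card :=
      not_le.1 (Nat.find_min hex (h ▸ t.lt_succ_self))
    have hsplit := Finset.card_filter_add_card_filter_not (s := s) (· < t)
    have hle : (s.filter (· < t + 1)).card ≤ (s.filter (· < t)).card + 1 := by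
      calc (s.filter (· < t + 1)).card ≤ (insert t (s.filter (· < t))).card := by
            refine Finset.card_le_card fun n hn => ?_
            simp only [Finset.mem_filter, Finset.mem_insert] at hn ⊢
            exact (Nat.lt_succ_iff_lt_or_eq.1 hn.2).elim (fun h => .inr ⟨hn.1, h⟩) .inl
        _ ≤ _ := Finset.card_insert_le _ _
    omega

/-- The Rademacher–Menshov maximal inequality: the squares of all partial sums, in the natural
order, of an orthogonal family indexed by a finite set with at most `2 ^ m` elements have a common
majorant with integral at most `(m + 1) ^ 2` times the sum of the squared norms. -/
theorem rademacher_menshov (hu : ∀ n, MemLp (u n) 2 μ)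
    (horth : ∀ i j, i ≠ j → ∫ x, u i x * u j x ∂μ = 0) (m : ℕ) :
    ∀ s : Finset ℕ, s.card ≤ 2 ^ m → ∃ Q : α → ℝ, Integrable Q μ ∧
      (∀ N x, (∑ n ∈ s with n < N, u n x) ^ 2 ≤ Q x) ∧
      ∫ x, Q x ∂μ ≤ (m + 1) ^ 2 * ∑ n ∈ s, ∫ x, u n x ^ 2 ∂μ := by
  induction m with
  | zero =>
    intro s hs
    refine ⟨fun x => (∑ n ∈ s, u n x) ^ 2, integrable_sq_sum hu s, fun N x => ?_, ?_⟩
    · rcases Finset.card_le_one_iff_subset_singleton.1 (by simpa using hs) with ⟨a, ha⟩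
      rcases Finset.subset_singleton_iff.1 ha with rfl | rfl
      · simp
      · rw [Finset.filter_singleton]
        split_ifs
        · exact le_rfl
        · simpa using sq_nonneg (u a x)
    · simp [integral_sq_sum_of_orthogonal hu horth]
  | succ m ih =>
    intro s hs
    obtain ⟨t, h1, h2⟩ := exists_threshold_card_le s (2 ^ m) (by rwa [pow_succ'] at hs)
    obtain ⟨Q₁, hi₁, hb₁, hI₁⟩ := ih _ h1
    obtain ⟨Q₂, hi₂, hb₂, hI₂⟩ := ih _ h2
    have hm : (0 : ℝ) < m + 1 := by positivity
    have hS := integrable_sq_sum hu (s.filter (· < t))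
    -- The Young weights are chosen so that the constants close up: `(m+2) + (1 + 1/(m+1)) (m+1)^2 =
    -- (m+2)^2`. The sum `Q₁ + Q₂` stands in for a maximum.
    refine ⟨fun x => (m + 2) * (∑ n ∈ s with n < t, u n x) ^ 2 +
      (1 + 1 / (m + 1)) * (Q₁ x + Q₂ x), (hS.const_mul _).add ((hi₁.add hi₂).const_mul _), ?_, ?_⟩
    · intro N x
      have hQ₁ := (sq_nonneg _).trans (hb₁ 0 x)
      have hQ₂ := (sq_nonneg _).trans (hb₂ 0 x)
      have hone : (1 : ℝ) ≤ 1 + 1 / (m + 1) := by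
        have : (0 : ℝ) < 1 / (m + 1) := by positivity
        linarith
      rcases le_total N t with hN | hN
      · have h := hb₁ N x
        rw [Finset.filter_filter] at h
        have hf : s.filter (fun n => n < t ∧ n < N) = s.filter (· < N) :=
          Finset.filter_congr fun n _ => by omega
        rw [hf] at h
        have h' : Q₁ x ≤ (1 + 1 / (m + 1)) * (Q₁ x + Q₂ x) := by nlinarith
        have : 0 ≤ ((m : ℝ) + 2) * (∑ n ∈ s with n < t, u n x) ^ 2 := by positivity
        linarith
      · have h := hb₂ N x
        rw [Finset.filter_filter] at h
        have hsum : ∑ n ∈ s with n < N, u n x = ∑ n ∈ s with n < t, u n x +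
            ∑ n ∈ s with ¬ n < t ∧ n < N, u n x := by
          rw [← Finset.sum_filter_add_sum_filter_not (s.filter (· < N)) (· < t),
            Finset.filter_filter, Finset.filter_filter]
          congr 1 <;> refine Finset.sum_congr (Finset.filter_congr fun n _ => by omega) fun _ _ => rfl
        rw [hsum]
        set A := ∑ n ∈ s with n < t, u n x
        set B := ∑ n ∈ s with ¬ n < t ∧ n < N, u n x
        have hyoung : (A + B) ^ 2 ≤ (m + 2) * A ^ 2 + (1 + 1 / (m + 1)) * B ^ 2 := by
          have : (m + 2) * A ^ 2 + (1 + 1 / (m + 1)) * B ^ 2 - (A + B) ^ 2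
              = ((m + 1) * A - B) ^ 2 / (m + 1) := by
            field_simp
            ring
          have h0 : 0 ≤ ((m + 1) * A - B) ^ 2 / ((m : ℝ) + 1) := by positivity
          linarith
        have : (1 + 1 / ((m : ℝ) + 1)) * B ^ 2 ≤ (1 + 1 / (m + 1)) * (Q₁ x + Q₂ x) := by
          gcongr
          linarith
        linarith
    · have hI : ∫ x, ((m + 2) * (∑ n ∈ s with n < t, u n x) ^ 2 +
          (1 + 1 / (m + 1)) * (Q₁ x + Q₂ x)) ∂μ = (m + 2) * ∑ n ∈ s with n < t,
          ∫ x, u n x ^ 2 ∂μ + (1 + 1 / ((m : ℝ) + 1)) * (∫ x, Q₁ x ∂μ + ∫ x, Q₂ x ∂μ) := by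
        rw [← integral_sq_sum_of_orthogonal hu horth, ← integral_add hi₁ hi₂,
          ← integral_const_mul, ← integral_const_mul]
        exact integral_add (hS.const_mul _) ((hi₁.add hi₂).const_mul _)
      rw [hI]
      have htot := Finset.sum_filter_add_sum_filter_not s (· < t) fun n => ∫ x, u n x ^ 2 ∂μ
      have hn₂ : 0 ≤ ∑ n ∈ s with ¬ n < t, ∫ x, u n x ^ 2 ∂μ :=
        Finset.sum_nonneg fun n _ => integral_nonneg fun x => sq_nonneg _
      rw [← htot]
      set X := ∑ n ∈ s with n < t, ∫ x, u n x ^ 2 ∂μ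
      set Y := ∑ n ∈ s with ¬ n < t, ∫ x, u n x ^ 2 ∂μ
      calc (m + 2) * X + (1 + 1 / ((m : ℝ) + 1)) * (∫ x, Q₁ x ∂μ + ∫ x, Q₂ x ∂μ)
          ≤ (m + 2) * (X + Y) + (1 + 1 / ((m : ℝ) + 1)) * ((m + 1) ^ 2 * X + (m + 1) ^ 2 * Y) := by
            gcongr
            linarith
        _ = ((m + 1 : ℕ) + 1) ^ 2 * (X + Y) := by
            push_cast
            field_simp
            ring

theorem ae_summable_of_summable_integral {Q : ℕ → α → ℝ} (hQ : ∀ k, Integrable (Q k) μ)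
    (h0 : ∀ k x, 0 ≤ Q k x) (hs : Summable fun k => ∫ x, Q k x ∂μ) :
    ∀ᵐ x ∂μ, Summable fun k => Q k x := by
  have hfin : ∫⁻ x, ∑' k, ENNReal.ofReal (Q k x) ∂μ ≠ ⊤ := by
    rw [lintegral_tsum fun k => (hQ k).aemeasurable.ennreal_ofReal]
    simp_rw [← ofReal_integral_eq_lintegral_ofReal (hQ _) (ae_of_all _ (h0 _))]
    exact hs.tsum_ofReal_ne_top
  have hmeas : AEMeasurable (fun x => ∑' k, ENNReal.ofReal (Q k x)) μ :=
    AEMeasurable.tsum fun k => (hQ k).aemeasurable.ennreal_ofReal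
  filter_upwards [ae_lt_top' hmeas hfin] with x hx
  have := ENNReal.summable_toReal hx.ne
  simpa only [ENNReal.toReal_ofReal (h0 _ x)] using this

/-- A series decomposed into blocks with finitely many terms each converges if the suprema of the
partial sums over the blocks are summable. -/
theorem exists_tendsto_sum_range_of_blocks (v : ℕ → ℝ) (κ : ℕ → ℕ) (G : ℕ → Finset ℕ)
    (hG : ∀ k n, n ∈ G k ↔ κ n = k) {F : ℕ → ℝ} (hF : Summable F)
    (hb : ∀ k N, |∑ n ∈ G k with n < N, v n| ≤ F k) :
    ∃ s, Tendsto (fun N => ∑ n ∈ Finset.range N, v n) atTop (𝓝 s) := by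
  refine ⟨∑' k, ∑ n ∈ G k, v n, ?_⟩
  have hblock : ∀ N, ∑ n ∈ Finset.range N, v n = ∑' k, ∑ n ∈ G k with n < N, v n := by
    intro N
    rw [tsum_eq_sum (s := (Finset.range N).image κ)]
    · rw [← Finset.sum_fiberwise_of_maps_to
        (fun n hn => Finset.mem_image_of_mem κ hn : ∀ n ∈ Finset.range N, _)]
      refine Finset.sum_congr rfl fun k _ => Finset.sum_congr ?_ fun _ _ => rfl
      ext n
      simp [hG, and_comm]
    · intro k hk
      refine Finset.sum_eq_zero fun n hn => absurd ?_ hk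
      simp only [Finset.mem_filter, hG] at hn
      exact Finset.mem_image.2 ⟨n, Finset.mem_range.2 hn.2, hn.1⟩
  simp_rw [hblock]
  -- Each truncated block is eventually the full block, and `F` dominates.
  refine tendsto_tsum_of_dominated_convergence hF (fun k => ?_)
    (Eventually.of_forall fun N k => hb k N)
  refine tendsto_const_nhds.congr' ?_
  filter_upwards [eventually_gt_atTop ((G k).sup id)] with N hN
  rw [Finset.filter_true_of_mem fun n hn =>
    show n < N from (Finset.le_sup (f := id) hn).trans_lt hN]

/-- Dyadic grouping of a positive sequence by size. -/
theorem exists_dyadic_level {b : ℕ → ℝ} (hb : ∀ n, 0 < b n) {p : ℝ} (hp0 : 0 < p) (hp : p < 2)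
    (hs : Summable fun n => b n ^ p) :
    ∃ (κ : ℕ → ℕ) (K : ℝ), 0 ≤ K ∧ (∀ n, (1 / 4 : ℝ) ^ (κ n + 1) ≤ b n ^ p) ∧
      ∀ n, b n ^ 2 ≤ K * ((1 / 2 : ℝ) ^ (2 - p)) ^ (κ n) * b n ^ p := by
  obtain ⟨D, hD⟩ : ∃ D, ∀ n, b n ^ p ≤ D :=
    ⟨∑' n, b n ^ p, fun n => hs.le_tsum n fun j _ => (Real.rpow_pos_of_pos (hb j) p).le⟩
  have hDb : ∀ n, b n ≤ D ^ p⁻¹ := fun n => by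
    rw [← Real.rpow_rpow_inv (hb n).le hp0.ne']
    exact Real.rpow_le_rpow (Real.rpow_pos_of_pos (hb n) p).le (hD n) (by positivity)
  have hD0 : 0 ≤ D ^ p⁻¹ := (hb 0).le.trans (hDb 0)
  -- The natural floor sends every `b n ≥ 1` to level `0`; the constant absorbs these finitely sized
  -- terms through the bound `D ^ p⁻¹`.
  refine ⟨fun n => ⌊-Real.logb 2 (b n)⌋₊, max 1 ((D ^ p⁻¹) ^ (2 - p)), by positivity,
    fun n => ?_, fun n => ?_⟩
  · have h1 : -Real.logb 2 (b n) < (⌊-Real.logb 2 (b n)⌋₊ : ℝ) + 1 := Nat.lt_floor_add_one _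
    set k := ⌊-Real.logb 2 (b n)⌋₊
    have h2 : (2 : ℝ) ^ (-((k : ℝ) + 1)) ≤ b n :=
      (Real.le_logb_iff_rpow_le one_lt_two (hb n)).1 (by linarith)
    calc (1 / 4 : ℝ) ^ (k + 1) = ((2 : ℝ) ^ (-((k : ℝ) + 1))) ^ (2 : ℝ) := by
          have h4 : (1 / 4 : ℝ) = 2 ^ (-2 : ℝ) := by
            rw [Real.rpow_neg zero_le_two]
            norm_num
          rw [← Real.rpow_natCast, h4, ← Real.rpow_mul zero_le_two, ← Real.rpow_mul zero_le_two]
          push_cast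
          ring_nf
      _ ≤ ((2 : ℝ) ^ (-((k : ℝ) + 1))) ^ p :=
          Real.rpow_le_rpow_of_exponent_ge (by positivity)
            (Real.rpow_le_one_of_one_le_of_nonpos one_le_two (by linarith [k.cast_nonneg (α := ℝ)]))
            hp.le
      _ ≤ b n ^ p := Real.rpow_le_rpow (by positivity) h2 hp0.le
  · have hsq : b n ^ 2 = b n ^ (2 - p) * b n ^ p := by
      rw [← Real.rpow_add (hb n)]
      norm_num
    rw [hsq]
    refine mul_le_mul_of_nonneg_right ?_ (Real.rpow_pos_of_pos (hb n) p).le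
    rcases Nat.eq_zero_or_pos ⌊-Real.logb 2 (b n)⌋₊ with h0 | hpos
    · simp only [h0, pow_zero, mul_one]
      exact (Real.rpow_le_rpow (hb n).le (hDb n) (by linarith)).trans (le_max_right _ _)
    · have h1 := Nat.floor_le (Nat.pos_of_floor_pos hpos).le
      set k := ⌊-Real.logb 2 (b n)⌋₊
      have h2 : b n ≤ (2 : ℝ) ^ (-(k : ℝ)) :=
        (Real.logb_le_iff_le_rpow one_lt_two (hb n)).1 (by linarith)
      have h3 : (2 : ℝ) ^ (-(k : ℝ)) = (1 / 2) ^ (k : ℝ) := by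
        rw [Real.rpow_neg zero_le_two, ← Real.inv_rpow zero_le_two, one_div]
      calc b n ^ (2 - p) ≤ ((1 / 2 : ℝ) ^ (k : ℝ)) ^ (2 - p) :=
            Real.rpow_le_rpow (hb n).le (h3 ▸ h2) (by linarith)
        _ = 1 * ((1 / 2 : ℝ) ^ (2 - p)) ^ k := by
            rw [one_mul, ← Real.rpow_natCast, ← Real.rpow_mul (by norm_num),
              ← Real.rpow_mul (by norm_num), mul_comm]
        _ ≤ _ := by
            gcongr
            exact le_max_left _ _

/-- AM–GM with a free parameter `l`: it turns control of squares into control of absolute values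
without square roots. -/
theorem abs_le_of_sq_le_of_pos {y q l : ℝ} (hl : 0 < l) (h : y ^ 2 ≤ q) :
    |y| ≤ l⁻¹ * q + l := by
  have h1 : |y| ^ 2 ≤ q := by rwa [sq_abs]
  have h2 : l⁻¹ * |y| ^ 2 ≤ l⁻¹ * q := by gcongr
  have h3 : l⁻¹ * |y| ^ 2 + l - |y| = l⁻¹ * ((|y| - l / 2) ^ 2 + 3 / 4 * l ^ 2) := by
    field_simp
    ring
  have h4 : 0 ≤ l⁻¹ * ((|y| - l / 2) ^ 2 + 3 / 4 * l ^ 2) := by positivity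
  linarith

/-- Half of the decay `r ^ k` pays for the weight; the other half, `√r ^ k`, beats the polynomial.
-/
theorem summable_polynomial_weight {r : ℝ} (hr0 : 0 < r) (hr1 : r < 1) (a : ℕ) (L : ℝ)
    (hL : 0 ≤ L) {I : ℕ → ℝ} (hI0 : ∀ k, 0 ≤ I k)
    (hI : ∀ k : ℕ, I k ≤ ((a : ℝ) + 2 * (k + 1) + 1) ^ 2 * (L * r ^ k)) :
    Summable fun k => (√r ^ k)⁻¹ * I k := by
  have hs0 : 0 < √r := Real.sqrt_pos.2 hr0
  have hs1 : √r < 1 := by rwa [Real.sqrt_lt' one_pos, one_pow]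
  have hrr : r = √r * √r := (Real.mul_self_sqrt hr0.le).symm
  generalize √r = s at hs0 hs1 hrr
  subst hrr
  have hpoly : Summable fun k : ℕ => ((a : ℝ) + 3) ^ 2 * L * (((k : ℝ) + 1) ^ 2 * s ^ k) := by
    refine Summable.mul_left _ ?_
    have h0 : Summable fun k : ℕ => (k : ℝ) ^ 2 * s ^ k :=
      summable_pow_mul_geometric_of_norm_lt_one 2 (by rwa [Real.norm_of_nonneg hs0.le])
    have h := (summable_nat_add_iff 1).2 h0
    refine (h.mul_left s⁻¹).congr fun k => ?_
    rw [pow_succ s k]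
    push_cast
    field_simp
  refine Summable.of_nonneg_of_le (fun k => mul_nonneg (by positivity) (hI0 k)) (fun k => ?_) hpoly
  have hlin : (a : ℝ) + 2 * (k + 1) + 1 ≤ (a + 3) * (k + 1) := by
    nlinarith [mul_nonneg (a.cast_nonneg (α := ℝ)) (k.cast_nonneg (α := ℝ)),
      k.cast_nonneg (α := ℝ)]
  calc (s ^ k)⁻¹ * I k
      ≤ (s ^ k)⁻¹ * (((a + 3 : ℝ) * (k + 1)) ^ 2 * (L * (s * s) ^ k)) := by
        refine mul_le_mul_of_nonneg_left ((hI k).trans ?_) (by positivity)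
        refine mul_le_mul_of_nonneg_right ?_ (by positivity)
        exact pow_le_pow_left₀ (by positivity) hlin 2
    _ = (a + 3 : ℝ) ^ 2 * L * (((k : ℝ) + 1) ^ 2 * s ^ k) := by
        rw [mul_pow s s k]
        field_simp

theorem ae_convergent_of_orthogonal_of_pos (hu : ∀ n, MemLp (u n) 2 μ)
    (horth : ∀ i j, i ≠ j → ∫ x, u i x * u j x ∂μ = 0) {b : ℕ → ℝ} (hb : ∀ n, 0 < b n)
    (hub : ∀ n, ∫ x, u n x ^ 2 ∂μ ≤ b n ^ 2) {p : ℝ} (hp0 : 0 < p) (hp : p < 2)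
    (hs : Summable fun n => b n ^ p) :
    ∀ᵐ x ∂μ, ∃ s, Tendsto (fun N => ∑ n ∈ Finset.range N, u n x) atTop (𝓝 s) := by
  obtain ⟨κ, K, hK, hlow, hupp⟩ := exists_dyadic_level hb hp0 hp hs
  have hbp : ∀ n, 0 ≤ b n ^ p := fun n => (Real.rpow_pos_of_pos (hb n) p).le
  obtain ⟨a, ha⟩ := pow_unbounded_of_one_lt (∑' n, b n ^ p) one_lt_two
  -- Each term of level `k` contributes at least `4^{-(k+1)}` to a sum below `2 ^ a`.
  have hcard : ∀ k (s : Finset ℕ), (∀ n ∈ s, κ n = k) → s.card ≤ 2 ^ (a + 2 * (k + 1)) := by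
    intro k s hsk
    have h1 : (s.card : ℝ) * (1 / 4) ^ (k + 1) ≤ 2 ^ a := by
      calc (s.card : ℝ) * (1 / 4) ^ (k + 1) = ∑ n ∈ s, (1 / 4 : ℝ) ^ (k + 1) := by simp
        _ ≤ ∑ n ∈ s, b n ^ p := Finset.sum_le_sum fun n hn => hsk n hn ▸ hlow n
        _ ≤ ∑' n, b n ^ p := hs.sum_le_tsum s fun n _ => hbp n
        _ ≤ 2 ^ a := ha.le
    have h2 : (s.card : ℝ) ≤ 2 ^ (a + 2 * (k + 1)) := by
      rw [pow_add, pow_mul]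
      rw [one_div, inv_pow, ← div_eq_mul_inv, div_le_iff₀ (by positivity)] at h1
      norm_num at h1 ⊢
      exact h1
    exact_mod_cast h2
  have hfinite : ∀ k, {n | κ n = k}.Finite := by
    intro k
    by_contra hinf
    obtain ⟨s, hsub, hc⟩ := Set.Infinite.exists_subset_card_eq hinf (2 ^ (a + 2 * (k + 1)) + 1)
    have := hcard k s fun n hn => hsub hn
    omega
  choose Q hQi hQb hQI using fun k =>
    rademacher_menshov hu horth (a + 2 * (k + 1)) (hfinite k).toFinset
      (hcard k _ fun n hn => by simpa using hn)
  set r : ℝ := (1 / 2 : ℝ) ^ (2 - p) with hr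
  have hr0 : 0 < r := by positivity
  have hr1 : r < 1 := Real.rpow_lt_one (by norm_num) (by norm_num) (by linarith)
  have hsr0 : 0 < √r := Real.sqrt_pos.2 hr0
  have hsr1 : √r < 1 := by rwa [Real.sqrt_lt' one_pos, one_pow]
  have hgeom : Summable fun k : ℕ => √r ^ k := summable_geometric_of_lt_one hsr0.le hsr1
  have hQ0 : ∀ k x, 0 ≤ Q k x := fun k x => (sq_nonneg _).trans (hQb k 0 x)
  have hblock : ∀ k, ∑ n ∈ (hfinite k).toFinset, ∫ x, u n x ^ 2 ∂μ ≤ K * 2 ^ a * r ^ k := by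
    intro k
    calc ∑ n ∈ (hfinite k).toFinset, ∫ x, u n x ^ 2 ∂μ
        ≤ ∑ n ∈ (hfinite k).toFinset, K * r ^ k * b n ^ p := by
          refine Finset.sum_le_sum fun n hn => (hub n).trans ?_
          have hn' : κ n = k := by simpa using hn
          exact hn' ▸ hupp n
      _ = K * r ^ k * ∑ n ∈ (hfinite k).toFinset, b n ^ p := by rw [Finset.mul_sum]
      _ ≤ K * r ^ k * 2 ^ a := by
          gcongr
          exact (hs.sum_le_tsum _ fun n _ => hbp n).trans ha.le
      _ = _ := by ring
  have hsumI : Summable fun k => ∫ x, (√r ^ k)⁻¹ * Q k x ∂μ := by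
    simp_rw [integral_const_mul]
    refine summable_polynomial_weight hr0 hr1 a (K * 2 ^ a) (by positivity)
      (fun k => integral_nonneg (hQ0 k)) fun k => ?_
    refine (hQI k).trans ?_
    rw [show (((a + 2 * (k + 1) : ℕ) : ℝ) + 1) = a + 2 * (k + 1) + 1 by push_cast; ring]
    exact mul_le_mul_of_nonneg_left (hblock k) (by positivity)
  filter_upwards [ae_summable_of_summable_integral (fun k => (hQi k).const_mul _)
    (fun k x => mul_nonneg (by positivity) (hQ0 k x)) hsumI] with x hx
  exact exists_tendsto_sum_range_of_blocks (fun n => u n x) κ (fun k => (hfinite k).toFinset)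
    (fun k n => by simp) (hx.add hgeom)
    fun k N => abs_le_of_sq_le_of_pos (by positivity) (hQb k N x)

/-- An orthogonal series with norms in `ℓ_p`, `p < 2`, converges almost everywhere. As the
hypothesis does not depend on the order of the terms, the convergence is unconditional. -/
theorem ae_convergent_of_orthogonal (hu : ∀ n, MemLp (u n) 2 μ)
    (horth : ∀ i j, i ≠ j → ∫ x, u i x * u j x ∂μ = 0) {c : ℕ → ℝ}
    (huc : ∀ n, ∫ x, u n x ^ 2 ∂μ ≤ c n ^ 2) {p : ℝ} (hp0 : 0 < p) (hp : p < 2)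
    (hs : Summable fun n => |c n| ^ p) :
    ∀ᵐ x ∂μ, ∃ s, Tendsto (fun N => ∑ n ∈ Finset.range N, u n x) atTop (𝓝 s) := by
  have hpos : ∀ n : ℕ, (0 : ℝ) < (1 / 2) ^ n := fun n => by positivity
  have hgeom : Summable fun n : ℕ => ((1 / 2 : ℝ) ^ n) ^ p := by
    refine (summable_geometric_of_lt_one (r := (1 / 2 : ℝ) ^ p) (by positivity)
      (Real.rpow_lt_one (by norm_num) (by norm_num) hp0)).congr fun n => ?_
    rw [← Real.rpow_natCast, ← Real.rpow_natCast, ← Real.rpow_mul (by norm_num),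
      ← Real.rpow_mul (by norm_num), mul_comm]
  -- The geometric floor makes the bounds positive, as the logarithmic levels require, and keeps
  -- them in `ℓ_p`.
  refine ae_convergent_of_orthogonal_of_pos hu horth (b := fun n => max |c n| ((1 / 2) ^ n))
    (fun n => lt_max_of_lt_right (hpos n)) (fun n => (huc n).trans ?_) hp0 hp ?_
  · rw [← sq_abs]
    exact pow_le_pow_left₀ (abs_nonneg _) (le_max_left _ _) 2
  · refine Summable.of_nonneg_of_le (fun n => by positivity) (fun n => ?_) (hs.add hgeom)
    rcases max_cases |c n| ((1 / 2 : ℝ) ^ n) with h | h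
    · rw [h.1]
      exact le_add_of_nonneg_right (by positivity)
    · rw [h.1]
      exact le_add_of_nonneg_left (by positivity)

end OrthogonalSeries

/-! ### Duality between `ℓ_p` and `ℓ_q` -/

section LpDuality

/-- Banach–Steinhaus makes the norms of the partial pairings uniformly bounded; testing on the
extremal sequence of Hölder's inequality recovers the `ℓ_p` norm. -/
theorem memℓp_of_bounded_pairing {p q : ℝ} (hpq : p.HolderConjugate q) (c : ℕ → ℝ)
    (h : ∀ a : ℕ → ℝ, Memℓp a (ENNReal.ofReal q) →
      ∃ B, ∀ n, |∑ k ∈ Finset.range n, a k * c k| ≤ B) :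
    Summable fun n => |c n| ^ p := by
  have hq0 : 0 < q := hpq.symm.pos
  have hp0 : 0 < p := hpq.pos
  have hqr : (ENNReal.ofReal q).toReal = q := ENNReal.toReal_ofReal hq0.le
  have : Fact (1 ≤ ENNReal.ofReal q) := ⟨by simpa using hpq.symm.lt.le⟩
  let T : ℕ → lp (fun _ : ℕ => ℝ) (ENNReal.ofReal q) →L[ℝ] ℝ := fun n =>
    ∑ k ∈ Finset.range n, c k • lp.evalCLM ℝ (fun _ : ℕ => ℝ) (ENNReal.ofReal q) k
  have hT : ∀ n a, T n a = ∑ k ∈ Finset.range n, a k * c k := by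
    intro n a
    simp only [T, FunLike.coe_sum, Finset.sum_apply]
    exact Finset.sum_congr rfl fun k _ => mul_comm _ _
  obtain ⟨B, hB⟩ : ∃ B, ∀ n, ‖T n‖ ≤ B := banach_steinhaus fun a => by
    obtain ⟨B, hB⟩ := h a (lp.memℓp a)
    exact ⟨B, fun n => by rw [hT]; exact hB n⟩
  have hB0 : 0 ≤ B := (norm_nonneg _).trans (hB 0)
  have hterm : ∀ k, 0 ≤ |c k| ^ p := fun k => by positivity
  refine summable_of_sum_range_le (c := B ^ p) hterm fun n => ?_
  set X := ∑ k ∈ Finset.range n, |c k| ^ p with hX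
  have hX0 : 0 ≤ X := Finset.sum_nonneg fun k _ => hterm k
  -- The equality case of Hölder: `w c = |w|^q = |c|^p`, whence `X ≤ B X^{1/q}`.
  let w : ℕ → ℝ := fun k => SignType.sign (c k) * |c k| ^ (p - 1)
  have hwc : ∀ k, w k * c k = |c k| ^ p := fun k => by
    rcases eq_or_ne (c k) 0 with h0 | h0
    · simp [w, h0, hp0.ne']
    · have habs : 0 < |c k| := abs_pos.2 h0
      calc w k * c k = (SignType.sign (c k) * c k) * |c k| ^ (p - 1) := by simp only [w]; ring
        _ = |c k| ^ p := by
          rw [sign_mul_self, Real.rpow_sub_one habs.ne', mul_div_cancel₀ _ habs.ne']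
  have hwq : ∀ k, ‖w k‖ ^ q = |c k| ^ p := fun k => by
    rcases eq_or_ne (c k) 0 with h0 | h0
    · simp [w, h0, hp0.ne', hq0.ne']
    · have hs : |((SignType.sign (c k) : SignType) : ℝ)| = 1 := by
        rcases h0.lt_or_gt with h | h <;> simp [h]
      rw [Real.norm_eq_abs, abs_mul, hs, one_mul, abs_of_nonneg (by positivity),
        ← Real.rpow_mul (abs_nonneg _), hpq.sub_one_mul_conj]
  let a : lp (fun _ : ℕ => ℝ) (ENNReal.ofReal q) :=
    ∑ k ∈ Finset.range n, lp.single (ENNReal.ofReal q) k (w k)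
  have ha : ‖a‖ ^ q = X := by
    have := lp.norm_sum_single (E := fun _ : ℕ => ℝ) (p := ENNReal.ofReal q) (by rwa [hqr]) w
      (Finset.range n)
    rw [hqr] at this
    rw [this]
    exact Finset.sum_congr rfl fun k _ => hwq k
  have hTa : T n a = X := by
    rw [hT]
    refine Finset.sum_congr rfl fun k hk => ?_
    rw [← hwc k]
    congr 1
    simp only [a, lp.coeFn_sum, Finset.sum_apply]
    rw [Finset.sum_eq_single_of_mem k hk fun j _ hj => lp.single_apply_ne _ _ _ hj.symm]
    exact lp.single_apply_self _ _ _
  have hle : X ≤ B * ‖a‖ := by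
    calc X ≤ ‖T n a‖ := hTa ▸ le_abs_self _
      _ ≤ B * ‖a‖ := (T n).le_of_opNorm_le (hB n) a
  have haX : ‖a‖ = X ^ q⁻¹ := by rw [← ha, Real.rpow_rpow_inv (norm_nonneg _) hq0.ne']
  rcases hX0.eq_or_lt with h0 | hpos
  · rw [← h0]
    positivity
  · have hpow : X ^ p⁻¹ ≤ B := by
      have h1 : X ^ p⁻¹ * X ^ q⁻¹ = X := by
        rw [← Real.rpow_add hpos, hpq.inv_add_inv_eq_one, Real.rpow_one]
      refine le_of_mul_le_mul_right ?_ (Real.rpow_pos_of_pos hpos q⁻¹)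
      rw [h1, ← haX]
      exact hle
    calc X = (X ^ p⁻¹) ^ p := (Real.rpow_inv_rpow hX0 hp0.ne').symm
      _ ≤ B ^ p := Real.rpow_le_rpow (by positivity) hpow hp0.le

theorem exists_bound_pairing {p q : ℝ} (hpq : p.HolderConjugate q) {a c : ℕ → ℝ}
    (ha : Memℓp a (ENNReal.ofReal q)) (hc : Memℓp c (ENNReal.ofReal p)) :
    ∃ B, ∀ n, |∑ k ∈ Finset.range n, a k * c k| ≤ B := by
  have hq0 := hpq.symm.pos
  have hp0 := hpq.pos
  have hqr : (ENNReal.ofReal q).toReal = q := ENNReal.toReal_ofReal hq0.le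
  have hpr : (ENNReal.ofReal p).toReal = p := ENNReal.toReal_ofReal hp0.le
  have hs : Summable fun k => ‖a k‖ * ‖c k‖ :=
    lp.summable_mul (E := fun _ : ℕ => ℝ) (by rw [hqr, hpr]; exact hpq.symm) ⟨a, ha⟩ ⟨c, hc⟩
  refine ⟨∑' k, ‖a k‖ * ‖c k‖, fun n => ?_⟩
  calc |∑ k ∈ Finset.range n, a k * c k| ≤ ∑ k ∈ Finset.range n, ‖a k‖ * ‖c k‖ := by
        refine (Finset.abs_sum_le_sum_abs _ _).trans_eq ?_
        exact Finset.sum_congr rfl fun k _ => abs_mul _ _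
    _ ≤ _ := hs.sum_le_tsum _ fun k _ => by positivity

theorem exists_abs_le_of_memℓp {a : ℕ → ℝ} {p : ENNReal} (ha : Memℓp a p) :
    ∃ A, 0 ≤ A ∧ ∀ n, |a n| ≤ A := by
  obtain ⟨A, hA⟩ := (ha.of_exponent_ge le_top).bddAbove
  exact ⟨A, (norm_nonneg _).trans (hA ⟨0, rfl⟩), fun n => hA ⟨n, rfl⟩⟩

end LpDuality

/-! ### Abel summation against a Lipschitz function -/

section AbelSummation

theorem sum_mul_sub_eq_by_parts (F G : ℕ → ℝ) (hG : G 0 = 0) (n : ℕ) (hn : 1 ≤ n) :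
    ∑ i ∈ Finset.range n, F (i + 1) * (G (i + 1) - G i) =
      F n * G n - ∑ i ∈ Finset.Ico 1 n, (F (i + 1) - F i) * G i := by
  induction n, hn using Nat.le_induction with
  | base => simp [hG]
  | succ n hn ih =>
    rw [Finset.sum_range_succ, ih, Finset.sum_Ico_succ_top hn]
    ring

/-- Quantitative Abel summation for the integral of a Lipschitz function against an integrable
function, along the uniform partition of `[0,1]` into `n` intervals. -/
theorem abs_integral_mul_le_of_lipschitz {f g : ℝ → ℝ} {K : NNReal}
    (hf : LipschitzOnWith K f (Icc 0 1)) (hg : IntervalIntegrable g volume 0 1) (n : ℕ)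
    (hn : 1 ≤ n) :
    |∫ x in (0 : ℝ)..1, f x * g x| ≤
      K * ((1 / (n : ℝ)) * ∑ i ∈ Finset.Ico 1 n, |∫ x in (0 : ℝ)..((i : ℝ) / n), g x|) +
      K / n * (∫ x in (0 : ℝ)..1, |g x|) + |f 1| * |∫ x in (0 : ℝ)..1, g x| := by
  have hn0 : (0 : ℝ) < n := by exact_mod_cast hn
  let t : ℕ → ℝ := fun i => (i : ℝ) / n
  have ht0 : t 0 = 0 := by simp [t]
  have htn : t n = 1 := div_self hn0.ne'
  have htm : ∀ {i j : ℕ}, i ≤ j → t i ≤ t j := fun hij =>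
    div_le_div_of_nonneg_right (by exact_mod_cast hij) hn0.le
  have htI : ∀ i ≤ n, t i ∈ Icc (0 : ℝ) 1 := fun i hi =>
    ⟨ht0 ▸ htm (Nat.zero_le i), htn ▸ htm hi⟩
  have hstep : ∀ i, t (i + 1) - t i = 1 / n := fun i => by
    simp only [t]
    push_cast
    ring
  have hsub : ∀ {h : ℝ → ℝ}, IntervalIntegrable h volume 0 1 → ∀ {i j : ℕ}, i ≤ n → j ≤ n →
      IntervalIntegrable h volume (t i) (t j) := fun hh i j hi hj =>
    hh.mono_set (by
      rw [uIcc_of_le (zero_le_one' ℝ)]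
      exact uIcc_subset_Icc (htI i hi) (htI j hj))
  have hfg : IntervalIntegrable (fun x => f x * g x) volume 0 1 :=
    hg.continuousOn_mul (by rw [uIcc_of_le (zero_le_one' ℝ)]; exact hf.continuousOn)
  let G : ℕ → ℝ := fun i => ∫ x in (0 : ℝ)..(t i), g x
  have hG0 : G 0 = 0 := by simp [G, ht0]
  have hGs : ∀ i < n, G (i + 1) - G i = ∫ x in (t i)..(t (i + 1)), g x := fun i hi => by
    have h1 := hsub hg (Nat.zero_le n) hi.le
    have h2 := hsub hg (Nat.zero_le n) (Nat.succ_le_of_lt hi)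
    rw [ht0] at h1 h2
    exact intervalIntegral.integral_interval_sub_left h2 h1
  have hsplit : ∀ {h : ℝ → ℝ}, IntervalIntegrable h volume 0 1 →
      ∑ i ∈ Finset.range n, ∫ x in (t i)..(t (i + 1)), h x = ∫ x in (0 : ℝ)..1, h x :=
    fun {h} hh => by
    have := intervalIntegral.sum_integral_adjacent_intervals (a := t) (f := h) (μ := volume)
      (n := n) fun i hi => hsub hh (Nat.le_of_lt hi) (Nat.succ_le_of_lt hi)
    rw [this, ht0, htn]
  -- Freezing `f` at the right endpoint of a cell costs at most `K / n` pointwise.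
  have hpiece : ∀ i < n, |(∫ x in (t i)..(t (i + 1)), f x * g x) - f (t (i + 1)) *
      (G (i + 1) - G i)| ≤ K / n * ∫ x in (t i)..(t (i + 1)), |g x| := by
    intro i hi
    have hgi := hsub hg hi.le (Nat.succ_le_of_lt hi)
    rw [hGs i hi, ← intervalIntegral.integral_const_mul, ← intervalIntegral.integral_sub
      (hsub hfg hi.le (Nat.succ_le_of_lt hi)) (hgi.const_mul _),
      ← intervalIntegral.integral_const_mul, ← Real.norm_eq_abs]
    refine intervalIntegral.norm_integral_le_of_norm_le (htm i.le_succ)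
      (ae_of_all _ fun x hx => ?_) (hgi.abs.const_mul _)
    have hx01 : x ∈ Icc (0 : ℝ) 1 :=
      ⟨(htI i hi.le).1.trans hx.1.le, hx.2.trans (htI (i + 1) hi).2⟩
    have hdist := hf.dist_le_mul x hx01 (t (i + 1)) (htI (i + 1) hi)
    rw [Real.dist_eq, Real.dist_eq, abs_sub_comm x, abs_of_nonneg (sub_nonneg.2 hx.2)] at hdist
    rw [← sub_mul, Real.norm_eq_abs, abs_mul]
    refine mul_le_mul_of_nonneg_right (hdist.trans ?_) (abs_nonneg _)
    rw [div_eq_mul_one_div, ← hstep i]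
    gcongr
    exact hx.1.le
  have hmain : ∫ x in (0 : ℝ)..1, f x * g x =
      ∑ i ∈ Finset.range n, ((∫ x in (t i)..(t (i + 1)), f x * g x) - f (t (i + 1)) *
      (G (i + 1) - G i)) + (f 1 * (∫ x in (0 : ℝ)..1, g x) -
      ∑ i ∈ Finset.Ico 1 n, (f (t (i + 1)) - f (t i)) * G i) := by
    have hparts := sum_mul_sub_eq_by_parts (fun i => f (t i)) G hG0 n hn
    simp only [htn] at hparts
    have hGn : G n = ∫ x in (0 : ℝ)..1, g x := by simp only [G, htn]
    rw [Finset.sum_sub_distrib, hsplit hfg, ← hGn, ← hparts]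
    ring
  have h1 : |∑ i ∈ Finset.range n, ((∫ x in (t i)..(t (i + 1)), f x * g x) - f (t (i + 1)) *
      (G (i + 1) - G i))| ≤ K / n * ∫ x in (0 : ℝ)..1, |g x| := by
    rw [← hsplit hg.abs, Finset.mul_sum]
    exact (Finset.abs_sum_le_sum_abs _ _).trans
      (Finset.sum_le_sum fun i hi => hpiece i (Finset.mem_range.1 hi))
  have h2 : |∑ i ∈ Finset.Ico 1 n, (f (t (i + 1)) - f (t i)) * G i| ≤
      K * ((1 / (n : ℝ)) * ∑ i ∈ Finset.Ico 1 n, |∫ x in (0 : ℝ)..((i : ℝ) / n), g x|) := by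
    rw [← mul_assoc, Finset.mul_sum]
    refine (Finset.abs_sum_le_sum_abs _ _).trans (Finset.sum_le_sum fun i hi => ?_)
    obtain ⟨_, hi⟩ := Finset.mem_Ico.1 hi
    rw [abs_mul]
    refine mul_le_mul_of_nonneg_right ?_ (abs_nonneg _)
    have hdist := hf.dist_le_mul (t (i + 1)) (htI (i + 1) hi) (t i) (htI i hi.le)
    rwa [Real.dist_eq, Real.dist_eq, hstep, abs_of_nonneg (by positivity : 0 ≤ 1 / (n : ℝ))]
      at hdist
  rw [hmain]
  have h3 := abs_sub (f 1 * ∫ x in (0 : ℝ)..1, g x)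
    (∑ i ∈ Finset.Ico 1 n, (f (t (i + 1)) - f (t i)) * G i)
  rw [abs_mul] at h3
  refine (abs_add_le _ _).trans ?_
  linarith

end AbelSummation

/-! ### Fourier coefficients of Lipschitz functions -/

section FourierCoefficients

variable {φ : ℕ → L2Unit}

theorem integral_mul_of_orthonormal (hφ : Orthonormal ℝ φ) (i j : ℕ) :
    ∫ x in Icc (0 : ℝ) 1, φ i x * φ j x = if i = j then 1 else 0 := by
  have h := orthonormal_iff_ite.1 hφ i j
  rw [L2.inner_def] at h
  rw [← h]
  refine integral_congr_ae (ae_of_all _ fun x => ?_)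
  simp [mul_comm]

theorem memLp_const_mul_system (φ : ℕ → L2Unit) (a : ℕ → ℝ) (n : ℕ) :
    MemLp (fun x => a n * φ n x) 2 (volume.restrict (Icc (0 : ℝ) 1)) :=
  (Lp.memLp (φ n)).const_mul (a n)

theorem integral_const_mul_mul_of_orthonormal (hφ : Orthonormal ℝ φ) (a : ℕ → ℝ) (i j : ℕ)
    (hij : i ≠ j) : ∫ x in Icc (0 : ℝ) 1, (a i * φ i x) * (a j * φ j x) = 0 := by
  simp_rw [mul_mul_mul_comm, integral_const_mul, integral_mul_of_orthonormal hφ, if_neg hij,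
    mul_zero]

theorem integral_sq_const_mul_of_orthonormal (hφ : Orthonormal ℝ φ) (a : ℕ → ℝ) (n : ℕ) :
    ∫ x in Icc (0 : ℝ) 1, (a n * φ n x) ^ 2 = a n ^ 2 := by
  simp_rw [pow_two, mul_mul_mul_comm, integral_const_mul, integral_mul_of_orthonormal hφ, if_true,
    mul_one]

theorem memLp_partialComb (φ : ℕ → L2Unit) (a : ℕ → ℝ) (n : ℕ) :
    MemLp (partialComb φ a n) 2 (volume.restrict (Icc (0 : ℝ) 1)) :=
  memLp_finsetSum _ fun k _ => memLp_const_mul_system φ a k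

theorem intervalIntegrable_of_memLp_two {g : ℝ → ℝ}
    (hg : MemLp g 2 (volume.restrict (Icc (0 : ℝ) 1))) : IntervalIntegrable g volume 0 1 :=
  (intervalIntegrable_iff_integrableOn_Icc_of_le zero_le_one).2 (hg.integrable one_le_two)

/-- AM–GM with parameter `n` and orthogonality. For bounded `a` this is `O(n)`, which suffices
against the factor `K / n`. -/
theorem integral_abs_partialComb_le (hφ : Orthonormal ℝ φ) (a : ℕ → ℝ) (n : ℕ) (hn : 1 ≤ n) :
    ∫ x in (0 : ℝ)..1, |partialComb φ a n x| ≤ (n : ℝ)⁻¹ * ∑ k ∈ Finset.range n, a k ^ 2 + n := by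
  have hn0 : (0 : ℝ) < n := by exact_mod_cast hn
  rw [intervalIntegral.integral_of_le zero_le_one, ← integral_Icc_eq_integral_Ioc]
  have hmem := memLp_partialComb φ a n
  have hsq : ∫ x in Icc (0 : ℝ) 1, partialComb φ a n x ^ 2 = ∑ k ∈ Finset.range n, a k ^ 2 := by
    simp_rw [← integral_sq_const_mul_of_orthonormal hφ a]
    exact integral_sq_sum_of_orthogonal (memLp_const_mul_system φ a)
      (integral_const_mul_mul_of_orthonormal hφ a) _
  have hint : Integrable (fun x => (n : ℝ)⁻¹ * partialComb φ a n x ^ 2)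
    (volume.restrict (Icc (0 : ℝ) 1)) := hmem.integrable_sq.const_mul _
  calc ∫ x in Icc (0 : ℝ) 1, |partialComb φ a n x|
      ≤ ∫ x in Icc (0 : ℝ) 1, ((n : ℝ)⁻¹ * partialComb φ a n x ^ 2 + n) :=
        integral_mono (hmem.integrable one_le_two).abs (hint.add (integrable_const _)) fun x =>
          abs_le_of_sq_le_of_pos hn0 le_rfl
    _ = _ := by
        rw [integral_add hint (integrable_const _), integral_const_mul, hsq]
        simp

theorem integral_mul_partialComb (φ : ℕ → L2Unit) (a : ℕ → ℝ) (n : ℕ) {f : ℝ → ℝ}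
    (hf : ContinuousOn f (Icc 0 1)) :
    ∫ x in (0 : ℝ)..1, f x * partialComb φ a n x =
      ∑ k ∈ Finset.range n, a k * fourierCoef φ f k := by
  have hint : ∀ k, IntervalIntegrable (fun x => f x * φ k x) volume 0 1 := fun k =>
    (intervalIntegrable_of_memLp_two (Lp.memLp (φ k))).continuousOn_mul
      (by rwa [uIcc_of_le (zero_le_one' ℝ)])
  simp only [partialComb, fourierCoef, Finset.mul_sum, mul_left_comm (f _)]
  rw [intervalIntegral.integral_finsetSum fun k _ => (hint k).const_mul _]
  simp_rw [intervalIntegral.integral_const_mul]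

/-- The Fourier coefficients of a Lipschitz function are in `ℓ_p`. -/
theorem summable_fourierCoef_of_lipschitz (hφ : Orthonormal ℝ φ) {p q : ℝ}
    (hpq : p.HolderConjugate q)
    (hC : Memℓp (fourierCoef φ (fun _ => 1)) (ENNReal.ofReal p))
    (hM : ∀ a : ℕ → ℝ, Memℓp a (ENNReal.ofReal q) →
      (fun n : ℕ => meanPrimitive φ a n) =O[atTop] (fun _ => (1 : ℝ)))
    {f : ℝ → ℝ} (hf : IsLip1 f) :
    Summable fun n => |fourierCoef φ f n| ^ p := by
  obtain ⟨K, hK⟩ := hf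
  refine memℓp_of_bounded_pairing hpq _ fun a ha => ?_
  obtain ⟨D, hD⟩ := Asymptotics.isBigO_one_nat_atTop_iff.1 (hM a ha)
  obtain ⟨E, hE⟩ := exists_bound_pairing hpq ha hC
  obtain ⟨A, hA0, hA⟩ := exists_abs_le_of_memℓp ha
  have hE0 : 0 ≤ E := (abs_nonneg _).trans (hE 0)
  have hD0 : 0 ≤ D := (norm_nonneg _).trans (hD 0)
  refine ⟨K * D + K * (A ^ 2 + 1) + |f 1| * E, fun n => ?_⟩
  rcases Nat.eq_zero_or_pos n with rfl | hn
  · simp only [Finset.range_zero, Finset.sum_empty, abs_zero]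
    positivity
  have hn1 : (1 : ℝ) ≤ n := by exact_mod_cast hn
  have hn0 : (0 : ℝ) < n := by linarith
  rw [← integral_mul_partialComb φ a n hK.continuousOn]
  refine (abs_integral_mul_le_of_lipschitz hK
    (intervalIntegrable_of_memLp_two (memLp_partialComb φ a n)) n hn).trans ?_
  have hmean : meanPrimitive φ a n ≤ D := (le_abs_self _).trans (hD n)
  have hone : |∫ x in (0 : ℝ)..1, partialComb φ a n x| ≤ E := by
    have h := integral_mul_partialComb φ a n (f := fun _ => 1) continuousOn_const
    simp only [one_mul] at h
    rw [h]
    exact hE n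
  have habs : (K : ℝ) / n * ∫ x in (0 : ℝ)..1, |partialComb φ a n x| ≤ K * (A ^ 2 + 1) := by
    have hsum : ∑ k ∈ Finset.range n, a k ^ 2 ≤ n * A ^ 2 := by
      calc ∑ k ∈ Finset.range n, a k ^ 2 ≤ ∑ k ∈ Finset.range n, A ^ 2 :=
            Finset.sum_le_sum fun k _ => by
              rw [← sq_abs]
              exact pow_le_pow_left₀ (abs_nonneg _) (hA k) 2
        _ = n * A ^ 2 := by simp
    calc (K : ℝ) / n * ∫ x in (0 : ℝ)..1, |partialComb φ a n x|
        ≤ K / n * ((n : ℝ)⁻¹ * (n * A ^ 2) + n) := by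
          gcongr
          refine (integral_abs_partialComb_le hφ a n hn).trans ?_
          gcongr
      _ = K * (A ^ 2 / n + 1) := by field_simp
      _ ≤ K * (A ^ 2 + 1) := by
          gcongr
          exact div_le_self (sq_nonneg A) hn1
  gcongr
  exact hmean

end FourierCoefficients

theorem corollary1 (φ : ℕ → L2Unit) (hφ : Orthonormal ℝ φ)
    (ε : ℝ) (hε : ε ∈ Ioo (0 : ℝ) 1)
    (hC : Memℓp (fourierCoef φ (fun _ => 1)) (ENNReal.ofReal (2 - ε)))
    (hM : ∀ a : ℕ → ℝ, Memℓp a (ENNReal.ofReal ((2 - ε) / (1 - ε))) →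
      (fun n : ℕ => meanPrimitive φ a n) =O[atTop] (fun _ => (1 : ℝ)))
    (f : ℝ → ℝ) (hf : IsLip1 f) :
    UnconditionallyConvergesAE (fun n x => fourierCoef φ f n * φ n x) := by
  obtain ⟨hε0, hε1⟩ := hε
  have hpq : (2 - ε).HolderConjugate ((2 - ε) / (1 - ε)) := by
    rw [Real.holderConjugate_iff_eq_conjExponent (by linarith)]
    congr 1
    ring
  have hsum := summable_fourierCoef_of_lipschitz hφ hpq hC hM hf
  -- Orthogonality and `ℓ_p` summability both survive composition with `σ`.
  intro σ
  exact ae_convergent_of_orthogonal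
    (fun n => memLp_const_mul_system φ (fourierCoef φ f) (σ n))
    (fun i j hij => integral_const_mul_mul_of_orthonormal hφ _ _ _ (σ.injective.ne hij))
    (fun n => (integral_sq_const_mul_of_orthonormal hφ (fourierCoef φ f) (σ n)).le)
    (by linarith) (by linarith) (hsum.comp_injective σ.injective)
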